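/- For integers $m,n$ let $BS(m,n)=\langle a,b \mid ba^{m}b^{-1}=a^{n}\rangle$ be the Baumslag–Solitar group, and let its Cayley graph with respect to $\{a,b\}$ be the simple graph whose vertices are the elements of $BS(m,n)$ and whose edges are the pairs $\{g,gs\}$ with $g\in BS(m,n)$, $s\in\{a^{\pm1},b^{\pm1}\}$, $gs\neq g$. A cycle in a graph is a closed path of length at least $3$ whose vertices are pairwise distinct except that the last one equals the first. A shortcut in a cycle $\gamma$ is a path $\sigma$ in the graph joining two vertices $p,q$ of $\gamma$ with $L(\sigma)<d_\gamma(p,q)$, where $L(\sigma)$ is the number of edges of $\sigma$ and $d_\gamma(p,q)$ is the length of the shorter of the two arcs of $\gamma$ between $p$ and $q$. A graph is $k$-chordal if every cycle of length at least $k$ in it has a shortcut. **Theorem.** The Cayley graph of $BS(1,2)$ with respect to $\{a,b\}$ is $6$-chordal. The same holds for $BS(m,n)$ for all integers $m,n$ with $\{|m|,|n|\}=\{1,2\}$, that is, for the groups $BS(\pm1,\pm2)$ and $BS(\pm2,\pm1)$ with all choices of signs. -/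

import Mathlib

/-- The relator `b a ^ m b⁻¹ (a ^ n)⁻¹` in the free group on `a = of 0` and `b = of 1`. -/
def baumslagSolitarRelator (m n : ℤ) : FreeGroup (Fin 2) :=
  FreeGroup.of 1 * FreeGroup.of 0 ^ m * (FreeGroup.of 1)⁻¹ * (FreeGroup.of 0 ^ n)⁻¹

/-- The Baumslag-Solitar group `BS(m, n) = ⟨a, b | b a ^ m b⁻¹ = a ^ n⟩`. -/
abbrev BaumslagSolitar (m n : ℤ) : Type :=
  PresentedGroup {baumslagSolitarRelator m n}

namespace BaumslagSolitar

/-- The generator `a`. -/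
def a (m n : ℤ) : BaumslagSolitar m n := PresentedGroup.of 0

/-- The generator `b`. -/
def b (m n : ℤ) : BaumslagSolitar m n := PresentedGroup.of 1

/-- The Cayley graph of `BS(m, n)` with respect to `{a, b}`: the vertices are the group elements
and the edges are the pairs `{g, g * s}` of distinct elements, with `s` in `{a, b}`. -/
def cayleyGraph (m n : ℤ) : SimpleGraph (BaumslagSolitar m n) :=
  SimpleGraph.mulCayley {a m n, b m n}

end BaumslagSolitar

/-- The distance, in the length metric of a cycle with `n` edges, between the vertices in
positions `i, j ≤ n` of that cycle: the length of the shorter of the two arcs joining them. -/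
def cycleDist (n i j : ℕ) : ℕ :=
  min (Nat.dist i j) (n - Nat.dist i j)

/-- The closed walk `γ` (meant to be a cycle) has a shortcut: two of its vertices are joined in
`G` by a path that is strictly shorter than their distance along `γ`. -/
def HasShortcut {V : Type*} {G : SimpleGraph V} {u : V} (γ : G.Walk u u) : Prop :=
  ∃ i ≤ γ.length, ∃ j ≤ γ.length, ∃ σ : G.Walk (γ.getVert i) (γ.getVert j),
    σ.length < cycleDist γ.length i j

/-- A graph is `k`-chordal if every cycle of length at least `k` has a shortcut. -/
def IsKChordal {V : Type*} (G : SimpleGraph V) (k : ℕ) : Prop :=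
  ∀ (u : V) (γ : G.Walk u u), γ.IsCycle → k ≤ γ.length → HasShortcut γ

/-! Read a shortcut-free closed walk of length at least 6 as a cyclic word in `a`, `b`, where `b a
b⁻¹ = a ^ c` and `|c| = 2`. Elements of height 0 commute with `a`, so `a`-letters can be moved along
subwords that return to the same height; each such rewriting that shortens an arc yields an
inequality on `L` (`isKChordal_six_of_conj`). These inequalities force all doubled letters `aa` or
`a⁻¹a⁻¹` to lie at one height and to have one sign (`Double.h_eq_h`, `Double.e_eq_e`). A local
maximum without a doubled letter would contain `b b⁻¹` or `b a^{±1} b⁻¹`, both of which are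
excluded, so that height is the maximum `K`, and below it the word only runs straight down and
straight up, with isolated `a`-letters.

Now let the group act affinely on `ℚ`: a letter `a^{±1}` at height `h` moves the translation part by
`2 ^ h` in absolute value. Each top plateau contributes at least `2 * 2 ^ K`, always with the same
sign, while a valley loses less than `2 * (2 ^ (K-1) + 2 ^ (K-2) + ...) = 2 * 2 ^ K`. Hence the walk
cannot close up. The accounting is done locally by `potential`. -/

/-- The combinatorial data of a closed path of length `L` without shortcuts in the Cayley graph of
a group generated by `a, b` with `b a b⁻¹ = a ^ c`, `|c| = 2`: the `i`-th letter is
`a ^ e i * b ^ u i`, the exponent sum of `b` before it is `h i`, and `x i` is the translation part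
of the `i`-th vertex acting on `ℚ` by affine maps. -/
structure ShortcutFreeLoop (L : ℤ) (c : ℚ) where
  e : ℤ → ℤ
  u : ℤ → ℤ
  h : ℤ → ℤ
  x : ℤ → ℚ
  six_le : 6 ≤ L
  abs_c : |c| = 2
  letter : ∀ i, (e i = 1 ∨ e i = -1) ∧ u i = 0 ∨ e i = 0 ∧ (u i = 1 ∨ u i = -1)
  h_succ : ∀ i, h (i + 1) = h i + u i
  x_succ : ∀ i, x (i + 1) = x i + e i * c ^ h i
  e_add : ∀ i, e (i + L) = e i
  u_add : ∀ i, u (i + L) = u i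
  h_add : ∀ i, h (i + L) = h i
  x_add : ∀ i, x (i + L) = x i
  opposite : ∀ i j, i < j → j < i + L → h i = h j → e i ≠ 0 → e j = -e i → L ≤ 2 * (j - i)
  square_up : ∀ i t, e i ≠ 0 → e (i + 1) = e i → i + 2 ≤ t → t < i + L → u t = 1 → h t = h i →
    L ≤ 2 * (t - i) + 1
  square_down : ∀ i t, e i ≠ 0 → e (i + 1) = e i → t < i → i + 2 ≤ t + L → u t = -1 →
    h (t + 1) = h i → L ≤ 2 * (i - t) + 3
  bump : ∀ i, u i = 1 → u (i + 1) = 0 → u (i + 2) ≠ -1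
  reduced : ∀ i, u i ≠ 0 → u (i + 1) ≠ -u i

/-! ### Doubled letters: one height, one sign. -/

namespace ShortcutFreeLoop

variable {L : ℤ} {c : ℚ} (P : ShortcutFreeLoop L c)

/-- Two consecutive letters at position `i` are both `a` or both `a⁻¹`. -/
def Double (i : ℤ) : Prop := P.u i = 0 ∧ P.u (i + 1) = 0

lemma add_mul {α : Type*} {f : ℤ → α} (hf : ∀ i, f (i + L) = f i) (k i : ℤ) :
    f (i + k * L) = f i := by
  have hp : Function.Periodic f L := hf
  simpa using hp.int_mul k i

lemma exists_congr_mem (P : ShortcutFreeLoop L c) (i j : ℤ) :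
    ∃ k, i ≤ j + k * L ∧ j + k * L < i + L := by
  have hL : 0 < L := by have := P.six_le; omega
  refine ⟨-((j - i) / L), ?_, ?_⟩
  · have := Int.emod_nonneg (j - i) hL.ne'
    have := Int.emod_add_mul_ediv (j - i) L
    linarith [mul_comm L ((j - i) / L)]
  · have := Int.emod_lt_of_pos (j - i) hL
    have := Int.emod_add_mul_ediv (j - i) L
    linarith [mul_comm L ((j - i) / L)]

lemma e_ne_zero {i : ℤ} (h : P.u i = 0) : P.e i ≠ 0 := by
  have := P.letter i; omega

lemma Double.e_eq {P : ShortcutFreeLoop L c} {i : ℤ} (hi : P.Double i) :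
    P.e (i + 1) = P.e i := by
  have h1 := P.letter i
  have h2 := P.letter (i + 1)
  have h3 := P.opposite i (i + 1) (by omega) (by have := P.six_le; omega)
    (by rw [P.h_succ, hi.1, add_zero]) (P.e_ne_zero hi.1)
  have := P.six_le
  have := hi.1
  have := hi.2
  omega

lemma Double.h_eq {P : ShortcutFreeLoop L c} {i : ℤ} (hi : P.Double i) :
    P.h (i + 1) = P.h i ∧ P.h (i + 2) = P.h i := by
  have h1 := P.h_succ i
  have h2 := P.h_succ (i + 1)
  rw [add_assoc] at h2
  norm_num at h2
  have := hi.1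
  have := hi.2
  omega

lemma Double.add {P : ShortcutFreeLoop L c} {i : ℤ} (hi : P.Double i) (k : ℤ) :
    P.Double (i + k * L) := by
  refine ⟨by rw [add_mul P.u_add]; exact hi.1, ?_⟩
  rw [add_right_comm, add_mul P.u_add]; exact hi.2

lemma exists_up (P : ShortcutFreeLoop L c) {p q k : ℤ} (hpq : p ≤ q) (hp : P.h p ≤ k)
    (hq : k < P.h q) : ∃ t, p ≤ t ∧ t < q ∧ P.h t = k ∧ P.u t = 1 := by
  induction q, hpq using Int.leInduction with
  | base => omega
  | succ q hpq ih =>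
    have h1 := P.h_succ q
    have h2 := P.letter q
    by_cases hk : k < P.h q
    · obtain ⟨t, h⟩ := ih hk
      exact ⟨t, by omega⟩
    · exact ⟨q, by omega⟩

lemma exists_down (P : ShortcutFreeLoop L c) {p q k : ℤ} (hpq : p ≤ q) (hp : k < P.h p)
    (hq : P.h q ≤ k) : ∃ t, p ≤ t ∧ t < q ∧ P.h (t + 1) = k ∧ P.u t = -1 := by
  induction q, hpq using Int.leInduction with
  | base => omega
  | succ q hpq ih =>
    have h1 := P.h_succ q
    have h2 := P.letter q
    by_cases hk : P.h q ≤ k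
    · obtain ⟨t, h⟩ := ih hk
      exact ⟨t, by omega⟩
    · exact ⟨q, by omega⟩

/-- Between a low double and a higher one the word must climb from the low level, and afterwards it
must return to it. The low double can be pushed forward through the climb or backward through the
descent, and the two arcs cannot both be long enough to avoid a shortcut. -/
lemma Double.not_h_lt {P : ShortcutFreeLoop L c} {i j : ℤ} (hi : P.Double i) (hj : P.Double j)
    (hij : i < j) (hjL : j < i + L) : ¬ P.h i < P.h j := by
  intro hlt
  have hi' := hi.h_eq
  have hj' := hj.h_eq
  have hiL := P.h_add i
  have h2 : i + 2 ≤ j := by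
    by_contra hc
    obtain rfl : j = i + 1 := by omega
    omega
  have h3 : j + 2 ≤ i + L := by
    by_contra hc
    have : i + L = j + 1 := by omega
    rw [this] at hiL
    omega
  obtain ⟨t, ht1, ht2, ht3, ht4⟩ := P.exists_up (k := P.h i) h2 (by omega) hlt
  obtain ⟨s, hs1, hs2, hs3, hs4⟩ := P.exists_down (k := P.h i) h3 (by omega) (by omega)
  have hd := hi.add 1
  rw [one_mul] at hd
  -- The two inequalities add up to `s - t ≤ 2`, whereas `t < j` and `j + 2 ≤ s`.
  have := P.square_up i t (P.e_ne_zero hi.1) hi.e_eq ht1 (by omega) ht4 ht3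
  have := P.square_down (i + L) s (P.e_ne_zero hd.1) hd.e_eq hs2 (by omega) hs4 (by omega)
  omega

lemma Double.h_eq_h {P : ShortcutFreeLoop L c} {i j : ℤ} (hi : P.Double i) (hj : P.Double j) :
    P.h i = P.h j := by
  obtain ⟨k, h1, h2⟩ := P.exists_congr_mem i j
  have hj' := hj.add k
  rw [← add_mul P.h_add k j]
  generalize j + k * L = j at *
  rcases h1.eq_or_lt with rfl | h1
  · rfl
  have hi' := hi.add 1
  rw [one_mul] at hi'
  have h3 := hi.not_h_lt hj' h1 h2
  have h4 := hj'.not_h_lt hi' h2 (by omega)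
  rw [P.h_add] at h4
  omega

lemma Double.e_eq_e {P : ShortcutFreeLoop L c} {i j : ℤ} (hi : P.Double i) (hj : P.Double j) :
    P.e i = P.e j := by
  obtain ⟨k, h1, h2⟩ := P.exists_congr_mem i j
  have hj' := hj.add k
  rw [← add_mul P.e_add k j]
  generalize j + k * L = j at *
  by_contra hne
  rcases h1.eq_or_lt with rfl | h1
  · exact hne rfl
  have hh := hi.h_eq_h hj'
  have := P.letter i
  have := P.letter j
  have := hi.1
  have := hj'.1
  have := hi.e_eq
  have hij : i + 1 ≠ j := by rintro rfl; omega
  -- Using the second letter of the double on one side and the first on the other makes the two arcs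
  -- add up to `L - 1`, although each must be at least `L / 2`.
  have h3 := P.opposite (i + 1) j (by omega) (by omega) (by rw [hi.h_eq.1, hh]) (by omega)
    (by omega)
  have h4 := P.opposite j (i + L) h2 (by omega) (by rw [P.h_add, hh]) (by omega)
    (by rw [P.e_add]; omega)
  omega

/-! ### Shape of the word at its extreme heights. -/

lemma exists_max (P : ShortcutFreeLoop L c) : ∃ i, ∀ j, P.h j ≤ P.h i := by
  have hL := P.six_le
  obtain ⟨i, -, hi⟩ := Finset.exists_max_image (Finset.Ico 0 L) P.h ⟨0, by simp; omega⟩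
  refine ⟨i, fun j => ?_⟩
  obtain ⟨k, h1, h2⟩ := P.exists_congr_mem 0 j
  rw [← add_mul P.h_add k j]
  exact hi _ (by simp; omega)

lemma exists_min (P : ShortcutFreeLoop L c) : ∃ i, ∀ j, P.h i ≤ P.h j := by
  have hL := P.six_le
  obtain ⟨i, -, hi⟩ := Finset.exists_min_image (Finset.Ico 0 L) P.h ⟨0, by simp; omega⟩
  refine ⟨i, fun j => ?_⟩
  obtain ⟨k, h1, h2⟩ := P.exists_congr_mem 0 j
  rw [← add_mul P.h_add k j]
  exact hi _ (by simp; omega)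

/-- The descent from a top plateau is preceded by at least two `a`-letters, since `reduced` excludes
none and `bump` excludes exactly one. Without a descent nearby, the letters at `i` and `i + 1`
already form a double. -/
lemma exists_double_of_max {i : ℤ} (hi : ∀ j, P.h j ≤ P.h i) :
    ∃ j, P.Double j ∧ P.h j = P.h i := by
  have key : ∀ i, (∀ j, P.h j ≤ P.h i) → P.u i = -1 → ∃ j, P.Double j ∧ P.h j = P.h i := by
    intro i hi hu
    have s1 := P.h_succ (i - 1)
    have s2 := P.h_succ (i - 2)
    have r1 := P.reduced (i - 1)
    have r2 := P.bump (i - 2)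
    have m1 := hi (i - 1)
    have m2 := hi (i - 2)
    have l1 := P.letter (i - 1)
    have l2 := P.letter (i - 2)
    rw [show i - 1 + 1 = i by ring] at s1 r1
    rw [show i - 2 + 1 = i - 1 by ring] at s2 r2
    rw [show i - 2 + 2 = i by ring] at r2
    refine ⟨i - 2, ⟨by omega, ?_⟩, by omega⟩
    rw [show i - 2 + 1 = i - 1 by ring]
    omega
  have s0 := P.h_succ i
  have s1 := P.h_succ (i + 1)
  have m0 := hi (i + 1)
  have m1 := hi (i + 1 + 1)
  have l0 := P.letter i
  have l1 := P.letter (i + 1)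
  by_cases hu : P.u i = -1
  · exact key i hi hu
  by_cases hu' : P.u (i + 1) = -1
  · have he : P.h (i + 1) = P.h i := by omega
    rw [← he]
    exact key (i + 1) (fun j => he ▸ hi j) hu'
  · exact ⟨i, ⟨by omega, by omega⟩, rfl⟩

lemma double_of_max {i : ℤ} (hi : ∀ j, P.h j ≤ P.h i) (hu : P.u i = 0) :
    P.Double i ∨ P.Double (i - 1) := by
  have s1 := P.h_succ (i - 1)
  have s0 := P.h_succ i
  have s2 := P.h_succ (i + 1)
  have r1 := P.bump (i - 1)
  have m1 := hi (i - 1)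
  have m2 := hi (i + 1 + 1)
  have l1 := P.letter (i - 1)
  have l2 := P.letter (i + 1)
  unfold Double
  rw [show i - 1 + 1 = i by ring] at *
  rw [show i - 1 + 2 = i + 1 by ring] at *
  omega

/-- These are the places where the potential estimate is strict. Before an ascent from the minimal
height there is exactly one `a`-letter, preceded by a descent, since a double would lie at height
`K`. If no such ascent exists, the word stays at the minimal height and all further letters are
`a`-letters. -/
lemma exists_strict {K : ℤ} (hK : ∀ i, P.h i ≤ K) (hd : ∀ i, P.Double i → P.h i = K) :
    ∃ i, P.u (i - 2) = -1 ∧ P.u (i - 1) = 0 ∧ P.u i = 1 ∨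
      P.u (i - 2) = 0 ∧ P.u (i - 1) = 0 ∧ P.u i = 0 := by
  obtain ⟨i₀, hmin⟩ := P.exists_min
  by_cases hex : ∃ i, P.h i = P.h i₀ ∧ P.u i = 1
  · obtain ⟨i, hi, hu⟩ := hex
    refine ⟨i, Or.inl ?_⟩
    have s0 := P.h_succ i
    have s1 := P.h_succ (i - 1)
    have s2 := P.h_succ (i - 2)
    have r1 := P.reduced (i - 1)
    have m1 := hmin (i - 1)
    have m2 := hmin (i - 2)
    have l1 := P.letter (i - 1)
    have l2 := P.letter (i - 2)
    have d2 := hd (i - 2)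
    have k1 := hK (i + 1)
    unfold Double at d2
    rw [show i - 1 + 1 = i by ring] at s1 r1
    rw [show i - 2 + 1 = i - 1 by ring] at s2 d2
    omega
  · push Not at hex
    have step : ∀ i, P.h i = P.h i₀ → P.u i = 0 ∧ P.h (i + 1) = P.h i₀ := by
      intro i hi
      have := hex i hi
      have := P.letter i
      have := hmin (i + 1)
      have := P.h_succ i
      omega
    have h0 := step i₀ rfl
    have h1 := step _ h0.2
    have h2 := step _ h1.2
    refine ⟨i₀ + 2, Or.inr ?_⟩
    rw [show i₀ + 2 - 2 = i₀ by ring, show i₀ + 2 - 1 = i₀ + 1 by ring,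
      show i₀ + 2 = i₀ + 1 + 1 by ring]
    exact ⟨h0.1, h1.1, h2.1⟩

/-! ### The potential and the contradiction. -/

/-- A potential which increases along the loop at most as fast as the translation part. It depends
on the two letters before the position and on the height. -/
noncomputable def potential (K i : ℤ) : ℚ :=
  if P.u (i - 1) = 1 then -2 ^ P.h i
  else if P.u (i - 1) = -1 then 2 * 2 ^ P.h i
  else if P.u (i - 2) = 1 then (if P.h i = K then 0 else -(2 * 2 ^ P.h i))
  else 2 ^ P.h i

lemma potential_add (K i : ℤ) : P.potential K (i + L) = P.potential K i := by
  unfold potential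
  rw [add_sub_right_comm, add_sub_right_comm, P.u_add, P.u_add, P.h_add]

/-- On the way down, the value `2 * 2 ^ h` on arrival pays for one adverse letter and leaves `2 ^ h
= 2 * 2 ^ (h - 1)` for the next level. On the way up, `-2 ^ h` drops by one adverse letter to `-(2 *
2 ^ h) = -2 ^ (h + 1)`. On the top plateau it climbs through `-2 ^ K`, `0`, `2 ^ K`, and `2 ^ K` is
where the descent starts. Further top letters, and the turn at the bottom of a valley, leave slack.
-/
lemma potential_succ_le {K : ℤ} (hK : ∀ i, P.h i ≤ K) (hd : ∀ i, P.Double i → P.h i = K)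
    {y : ℤ → ℚ} (h0 : ∀ i, P.u i ≠ 0 → y (i + 1) = y i)
    (h1 : ∀ i, y i - 2 ^ P.h i ≤ y (i + 1))
    (h2 : ∀ i, P.u i = 0 → P.h i = K → y (i + 1) = y i + 2 ^ K) (i : ℤ) :
    P.potential K (i + 1) - P.potential K i ≤ y (i + 1) - y i ∧
      ((P.u (i - 2) = -1 ∧ P.u (i - 1) = 0 ∧ P.u i = 1 ∨
        P.u (i - 2) = 0 ∧ P.u (i - 1) = 0 ∧ P.u i = 0) →
        P.potential K (i + 1) - P.potential K i < y (i + 1) - y i) := by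
  have g0 := h0 i
  have g1 := h1 i
  have g2 := h2 i
  have s0 := P.h_succ i
  have s1 := P.h_succ (i - 1)
  have s2 := P.h_succ (i - 2)
  have r1 := P.reduced (i - 1)
  have b2 := P.bump (i - 2)
  have l0 := P.letter i
  have l1 := P.letter (i - 1)
  have l2 := P.letter (i - 2)
  have d1 := hd (i - 1)
  have d2 := hd (i - 2)
  have k0 := hK i
  have k1 := hK (i + 1)
  have k2 := hK (i - 2)
  unfold Double at d1 d2
  unfold potential
  rw [show i + 1 - 1 = i by ring, show i + 1 - 2 = i - 1 by ring]
  rw [show i - 1 + 1 = i by ring] at s1 r1 d1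
  rw [show i - 2 + 1 = i - 1 by ring] at s2 d2 b2
  rw [show i - 2 + 2 = i by ring] at b2
  have hpos : (0 : ℚ) < 2 ^ P.h i := by positivity
  have hup : (2 : ℚ) ^ (P.h i + 1) = 2 * 2 ^ P.h i := by
    rw [zpow_add₀ two_ne_zero, zpow_one, mul_comm]
  have hdown : (2 : ℚ) ^ (P.h i + -1) = 2 ^ P.h i / 2 := by
    rw [zpow_add₀ two_ne_zero, zpow_neg_one, div_eq_mul_inv]
  have c0 : P.u i = 1 ∨ P.u i = -1 ∨ P.u i = 0 := by omega
  have c1 : P.u (i - 1) = 1 ∨ P.u (i - 1) = -1 ∨ P.u (i - 1) = 0 := by omega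
  have c2 : P.u (i - 2) = 1 ∨ P.u (i - 2) = -1 ∨ P.u (i - 2) = 0 := by omega
  have g2' : P.u i = 0 → P.h i = K → y (i + 1) = y i + 2 ^ P.h i := fun hu hk => hk ▸ g2 hu hk
  rw [s0] at k1
  rw [s0]
  clear l0 l1 l2 hK hd h0 h1 h2 g2 s0
  -- All patterns of three consecutive letters, at the top or below; `omega` discards those excluded
  -- by `reduced`, `bump` or the heights.
  rcases c0 with c0 | c0 | c0 <;> rcases c1 with c1 | c1 | c1 <;>
    rcases c2 with c2 | c2 | c2 <;> by_cases hk : P.h i = K <;>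
    simp only [c0, c1, c2] at * <;> norm_num at * <;> first | omega | skip
  all_goals
    first | replace g2' := g2' hk | skip
    first | rw [if_pos hk] | rw [if_neg hk] | skip
    first | linarith | exact ⟨by linarith, by linarith⟩

theorem false (P : ShortcutFreeLoop L c) : False := by
  obtain ⟨m, hm⟩ := P.exists_max
  obtain ⟨d, hd, hdm⟩ := P.exists_double_of_max hm
  obtain ⟨K, hK⟩ : ∃ K, K = P.h m := ⟨_, rfl⟩
  rw [← hK] at hm hdm
  have habs : ∀ k : ℤ, |c ^ k| = 2 ^ k := fun k => by rw [abs_zpow, P.abs_c]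
  have hsq : (P.e d : ℚ) * P.e d = 1 := by
    have h1 := P.letter d
    have h2 := hd.1
    rcases (show P.e d = 1 ∨ P.e d = -1 by omega) with h | h <;> rw [h] <;> norm_num
  have hpow : (0 : ℚ) < 2 ^ K := by positivity
  have hcK : c ^ K * c ^ K = 2 ^ K * 2 ^ K := by rw [← abs_mul_abs_self, habs]
  -- The sign that makes every top letter contribute `+2 ^ K`; below the top only absolute values
  -- matter, so a negative `c` does no harm.
  set τ : ℚ := P.e d * c ^ K / 2 ^ K with hτ
  have hτ1 : |τ| = 1 := by
    rw [← sq_eq_sq₀ (abs_nonneg _) zero_le_one, sq_abs, hτ]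
    field_simp
    linear_combination (c ^ K * c ^ K) * hsq + hcK
  have hdh : ∀ i, P.Double i → P.h i = K := fun i hi => (hi.h_eq_h hd).trans hdm
  have hstep := P.potential_succ_le hm hdh (y := fun i => τ * P.x i)
    (fun i hi => by
      have : P.e i = 0 := by have := P.letter i; omega
      rw [P.x_succ, this]; simp)
    (fun i => by
      have h1 : |τ * (P.e i * c ^ P.h i)| ≤ 2 ^ P.h i := by
        rw [abs_mul, abs_mul, hτ1, habs, one_mul]
        have : |(P.e i : ℚ)| ≤ 1 := by
          have := P.letter i
          rcases (show P.e i = 1 ∨ P.e i = -1 ∨ P.e i = 0 by omega) with h | h | h <;>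
            rw [h] <;> norm_num
        exact mul_le_of_le_one_left (by positivity) this
      have := (abs_le.1 h1).1
      rw [P.x_succ]
      linarith)
    (fun i hu hi => by
      have hed : P.e i = P.e d := by
        rcases P.double_of_max (i := i) (fun j => hi ▸ hm j) hu with h | h
        · exact h.e_eq_e hd
        · have := h.e_eq
          rw [show i - 1 + 1 = i by ring] at this
          exact this.trans (h.e_eq_e hd)
      rw [P.x_succ, hi, hed, hτ]
      field_simp
      linear_combination (c ^ K * c ^ K) * hsq + hcK)
  -- `z` is monotone and `L`-periodic, hence constant, against the strict step.
  set z : ℤ → ℚ := fun i => τ * P.x i - P.potential K i with hz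
  have hmono : Monotone z := monotone_int_of_le_succ fun i => by
    have := (hstep i).1
    simp only [hz]
    linarith
  obtain ⟨i, hi⟩ := P.exists_strict hm hdh
  have h1 : z i < z (i + 1) := by
    have := (hstep i).2 hi
    simp only [hz]
    linarith
  have h2 : z (i + 1) ≤ z (i + L) := hmono (by have := P.six_le; omega)
  have h3 : z (i + L) = z i := by simp only [hz]; rw [P.x_add, P.potential_add]
  linarith

end ShortcutFreeLoop

/-! ### Walks in Cayley graphs and cyclic indexing. -/

open scoped Pointwise

/-- The generators of a Cayley graph, their inverses and the identity. -/
def stepSet {G : Type*} [Group G] (a b : G) : Set G := {1, a, a⁻¹, b, b⁻¹}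

section Walks

variable {G : Type*} [Group G] {a b : G}

lemma exists_walk_of_mem_stepSet_pow {n : ℕ} :
    ∀ {x g : G}, g ∈ stepSet a b ^ n →
      ∃ w : (SimpleGraph.mulCayley {a, b}).Walk x (x * g), w.length ≤ n := by
  induction n with
  | zero =>
    intro x g hg
    obtain rfl : g = 1 := by simpa using hg
    exact ⟨SimpleGraph.Walk.nil.copy rfl (mul_one x).symm, by simp⟩
  | succ n ih =>
    intro x g hg
    rw [pow_succ] at hg
    obtain ⟨g, hg', s, hs, rfl⟩ := Set.mem_mul.1 hg
    obtain ⟨w, hw⟩ := ih (x := x) hg'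
    by_cases h1 : s = 1
    · subst h1
      exact ⟨w.copy rfl (by rw [mul_one]), by simp; omega⟩
    · have hadj : (SimpleGraph.mulCayley {a, b}).Adj (x * g) (x * (g * s)) := by
        rw [SimpleGraph.mulCayley_adj', ← mul_assoc]
        refine ⟨by simpa [eq_comm] using h1, ?_⟩
        rcases hs with rfl | rfl | rfl | rfl | rfl
        · exact absurd rfl h1
        · exact ⟨s, by simp, Or.inl rfl⟩
        · exact ⟨a, by simp, Or.inr (by group)⟩
        · exact ⟨s, by simp, Or.inl rfl⟩
        · exact ⟨b, by simp, Or.inr (by group)⟩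
      exact ⟨w.concat hadj, by simpa using hw⟩

/-- The vertices of a closed walk, indexed periodically by the integers. -/
def cyclicVert {V : Type*} {Γ : SimpleGraph V} {x : V} (γ : Γ.Walk x x) (i : ℤ) : V :=
  γ.getVert (i % γ.length).toNat

section CyclicVert

variable {V : Type*} {Γ : SimpleGraph V} {x : V} (γ : Γ.Walk x x)

lemma cyclicVert_add (i : ℤ) : cyclicVert γ (i + γ.length) = cyclicVert γ i := by
  simp [cyclicVert]

lemma cyclicVert_natCast {n : ℕ} (hn : n ≤ γ.length) : cyclicVert γ n = γ.getVert n := by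
  rcases hn.lt_or_eq with h | rfl
  · rw [cyclicVert, Int.emod_eq_of_lt (by positivity) (by exact_mod_cast h), Int.toNat_natCast]
  · simp [cyclicVert]

lemma cyclicVert_adj (hγ : 0 < γ.length) (i : ℤ) :
    Γ.Adj (cyclicVert γ i) (cyclicVert γ (i + 1)) := by
  have h0 : 0 ≤ i % γ.length := Int.emod_nonneg _ (by omega)
  have hlt : i % γ.length < γ.length := Int.emod_lt_of_pos _ (by omega)
  have h1 : cyclicVert γ (i + 1) = γ.getVert ((i % γ.length).toNat + 1) := by
    rw [← cyclicVert_natCast γ (by omega)]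
    push_cast
    rw [Int.toNat_of_nonneg h0]
    simp [cyclicVert]
  rw [h1]
  exact γ.adj_getVert_succ (by omega)

lemma not_hasShortcut_le (hγ : ¬ HasShortcut γ) (h0 : 0 < γ.length) (i : ℤ) {n : ℕ}
    (hn : n ≤ γ.length)
    (w : Γ.Walk (cyclicVert γ i) (cyclicVert γ (i + n))) : min n (γ.length - n) ≤ w.length := by
  by_contra hlt
  apply hγ
  have b0 : 0 ≤ i % γ.length := Int.emod_nonneg _ (by omega)
  have b1 : i % γ.length < γ.length := Int.emod_lt_of_pos _ (by omega)
  have c0 : 0 ≤ (i + n) % γ.length := Int.emod_nonneg _ (by omega)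
  have c1 : (i + n) % γ.length < γ.length := Int.emod_lt_of_pos _ (by omega)
  refine ⟨(i % γ.length).toNat, by omega, ((i + n) % γ.length).toNat, by omega, w, ?_⟩
  refine (not_le.1 hlt).trans_le ?_
  have hd : (γ.length : ℤ) ∣ (i + n) % γ.length - (i % γ.length + n) := by
    apply Int.dvd_of_emod_eq_zero
    rw [← Int.emod_emod_of_dvd _ dvd_rfl]
    simp [Int.sub_emod]
  obtain ⟨k, hk⟩ := hd
  -- The arc of length `n` either stays within one period or crosses the base point once; in the
  -- latter case the positions differ by `γ.length - n`, which has the same cyclic distance.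
  have hk0 : k = 0 ∨ k = -1 := by
    have h1 : k < 1 := by by_contra hc; nlinarith
    have h2 : -2 < k := by by_contra hc; nlinarith
    omega
  unfold cycleDist Nat.dist
  rcases hk0 with rfl | rfl <;> omega

end CyclicVert
end Walks

/-! ### From shortcut-free cycles to combinatorial data. -/

section Group

variable {G : Type*} [Group G] {a b : G} {c : ℤ}

lemma mul_zpow_of_conj (rel : b * a * b⁻¹ = a ^ c) (k : ℤ) : b * a ^ k = a ^ (c * k) * b := by
  have h : b * a ^ k * b⁻¹ = a ^ (c * k) := by
    rw [← conj_zpow, rel, zpow_mul]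
  rw [← h]; group

lemma conj_pow_eq (rel : b * a * b⁻¹ = a ^ c) (n : ℕ) :
    b ^ n * a * (b ^ n)⁻¹ = a ^ (c ^ n) := by
  induction n with
  | zero => simp
  | succ n ih =>
    have : b ^ (n + 1) * a * (b ^ (n + 1))⁻¹ = b * (b ^ n * a * (b ^ n)⁻¹) * b⁻¹ := by
      rw [pow_succ']; group
    rw [this, ih, mul_zpow_of_conj rel, pow_succ', mul_inv_cancel_right]

/-- For `k ≥ 0` the conjugate is a power of `a`; for `k < 0`, conjugate that statement back. -/
lemma commute_conj_zpow (rel : b * a * b⁻¹ = a ^ c) (k : ℤ) :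
    Commute (b ^ k * a * (b ^ k)⁻¹) a := by
  obtain ⟨n, rfl | rfl⟩ := k.eq_nat_or_neg
  · rw [zpow_natCast, conj_pow_eq rel]
    exact (Commute.refl a).zpow_left _
  · have h : Commute (b ^ n * a * (b ^ n)⁻¹) a := by
      rw [conj_pow_eq rel]
      exact (Commute.refl a).zpow_left _
    have h' := (Commute.conj_iff (b ^ n)⁻¹).2 h.symm
    have h2 : (b ^ n)⁻¹ * (b ^ n * a * (b ^ n)⁻¹) * (b ^ n)⁻¹⁻¹ = a := by group
    rw [h2] at h'
    simpa using h'

variable (ht : G →* Multiplicative ℤ)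

/-- Stripping the height from `g` leaves a product of conjugates `b ^ k * a^{±1} * b ^ (-k)`, one
for each letter `a^{±1}` of a word for `g`. -/
lemma commute_mul_zpow_height (rel : b * a * b⁻¹ = a ^ c) (hta : ht a = 1)
    (htb : ht b = Multiplicative.ofAdd 1) (gen : Subgroup.closure {a, b} = ⊤) (g : G) :
    Commute (g * b ^ (-(ht g).toAdd)) a := by
  have hg : g ∈ Subgroup.closure {a, b} := gen ▸ Subgroup.mem_top g
  induction hg using Subgroup.closure_induction_right with
  | one => simp
  | mul_right x hx y hy ih =>
    rcases hy with rfl | rfl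
    · have : x * y * b ^ (-(ht (x * y)).toAdd) = x * b ^ (-(ht x).toAdd) *
          (b ^ ((ht x).toAdd) * y * (b ^ ((ht x).toAdd))⁻¹) := by
        rw [map_mul, hta, mul_one]; group
      rw [this]
      exact ih.mul_left (commute_conj_zpow rel _)
    · have : x * y * y ^ (-(ht (x * y)).toAdd) = x * y ^ (-(ht x).toAdd) := by
        rw [map_mul, htb, toAdd_mul, toAdd_ofAdd]; group
      rwa [this]
  | mul_inv_cancel x hx y hy ih =>
    rcases hy with rfl | rfl
    · have : x * y⁻¹ * b ^ (-(ht (x * y⁻¹)).toAdd) = x * b ^ (-(ht x).toAdd) *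
          (b ^ ((ht x).toAdd) * y * (b ^ ((ht x).toAdd))⁻¹)⁻¹ := by
        rw [map_mul, map_inv, hta, inv_one, mul_one]; group
      rw [this]
      exact ih.mul_left (commute_conj_zpow rel _).inv_left
    · have : x * y⁻¹ * y ^ (-(ht (x * y⁻¹)).toAdd) = x * y ^ (-(ht x).toAdd) := by
        rw [map_mul, map_inv, htb, toAdd_mul, toAdd_inv, toAdd_ofAdd]; group
      rwa [this]

lemma commute_of_height_eq (rel : b * a * b⁻¹ = a ^ c) (hta : ht a = 1)
    (htb : ht b = Multiplicative.ofAdd 1) (gen : Subgroup.closure {a, b} = ⊤) {g g' : G}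
    (h : (ht g).toAdd = (ht g').toAdd) : Commute (g⁻¹ * g') a := by
  have h1 := commute_mul_zpow_height ht rel hta htb gen (g⁻¹ * g')
  have h2 : ht (g⁻¹ * g') = 1 := by
    rw [map_mul, map_inv, inv_mul_eq_one]
    exact h
  rwa [h2, toAdd_one, neg_zero, zpow_zero, mul_one] at h1

lemma zpow_mem_stepSet_left {k : ℤ} (hk : k = 1 ∨ k = -1) : a ^ k ∈ stepSet a b := by
  rcases hk with rfl | rfl <;> simp [stepSet]

/-- The implication sits inside the existential so that `choose` gives exponents as total functions
on `G`. -/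
lemma exists_letter (a b : G) (g : G) : ∃ p : ℤ × ℤ,
    (∃ s ∈ ({a, b} : Set G), s = g ∨ s = g⁻¹) → g = a ^ p.1 * b ^ p.2 ∧
      ((p.1 = 1 ∨ p.1 = -1) ∧ p.2 = 0 ∨ p.1 = 0 ∧ (p.2 = 1 ∨ p.2 = -1)) := by
  by_cases h : ∃ s ∈ ({a, b} : Set G), s = g ∨ s = g⁻¹
  · obtain ⟨s, rfl | rfl, rfl | h⟩ := h
    · exact ⟨(1, 0), fun _ => by simp⟩
    · exact ⟨(-1, 0), fun _ => by simp [h]⟩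
    · exact ⟨(0, 1), fun _ => by simp⟩
    · exact ⟨(0, -1), fun _ => by simp [h]⟩
  · exact ⟨0, fun h' => absurd h' h⟩

/-- If `b a b⁻¹ = a ^ (± 2)` in a group generated by `a` and `b`, if the exponent sum of `b` is
well defined, and if `x` is the translation part of a compatible affine action on `ℚ`, then the
Cayley graph is `6`-chordal. -/
theorem isKChordal_six_of_conj (hc : c = 2 ∨ c = -2) (rel : b * a * b⁻¹ = a ^ c) (hta : ht a = 1)
    (htb : ht b = Multiplicative.ofAdd 1) (gen : Subgroup.closure {a, b} = ⊤) (x : G → ℚ)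
    (hxa : ∀ g, x (g * a) = x g + (c : ℚ) ^ (ht g).toAdd) (hxb : ∀ g, x (g * b) = x g) :
    IsKChordal (SimpleGraph.mulCayley {a, b}) 6 := by
  intro o γ _ hL
  by_contra hγ
  have hpos : 0 < γ.length := by omega
  obtain ⟨L, hLdef⟩ : ∃ L : ℤ, L = γ.length := ⟨_, rfl⟩
  set v : ℤ → G := cyclicVert γ with hv
  have hvL : ∀ i, v (i + L) = v i := fun i => hLdef ▸ cyclicVert_add γ i
  choose p hp using exists_letter a b
  have hstep : ∀ i, (v i)⁻¹ * v (i + 1) =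
      a ^ (p ((v i)⁻¹ * v (i + 1))).1 * b ^ (p ((v i)⁻¹ * v (i + 1))).2 ∧ _ := fun i => by
    refine hp _ ?_
    have h := cyclicVert_adj γ hpos i
    rw [SimpleGraph.mulCayley_adj', ← hv] at h
    obtain ⟨-, s, hs, h | h⟩ := h
    · exact ⟨s, hs, Or.inl (eq_inv_mul_of_mul_eq h)⟩
    · exact ⟨s, hs, Or.inr (by rw [h]; group)⟩
  set e : ℤ → ℤ := fun i => (p ((v i)⁻¹ * v (i + 1))).1 with he
  set u : ℤ → ℤ := fun i => (p ((v i)⁻¹ * v (i + 1))).2 with hu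
  have letter : ∀ i, (e i = 1 ∨ e i = -1) ∧ u i = 0 ∨ e i = 0 ∧ (u i = 1 ∨ u i = -1) :=
    fun i => (hstep i).2
  have hvs : ∀ i, v (i + 1) = v i * (a ^ e i * b ^ u i) := fun i => by
    rw [← (hstep i).1]; group
  have heL : ∀ i, e (i + L) = e i := fun i => by
    simp only [he]
    rw [add_right_comm, hvL, hvL]
  have huL : ∀ i, u (i + L) = u i := fun i => by
    simp only [hu]
    rw [add_right_comm, hvL, hvL]
  have hgeo : ∀ (n d : ℕ) (j : ℤ), (n : ℤ) ≤ L → (v j)⁻¹ * v (j + n) ∈ stepSet a b ^ d →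
      n ≤ d ∨ L ≤ n + d := by
    intro n d j hn hd
    obtain ⟨w, hw⟩ := exists_walk_of_mem_stepSet_pow (x := v j) hd
    have := not_hasShortcut_le γ hγ hpos j (n := n) (by omega) (w.copy rfl (by rw [← hv]; group))
    rw [SimpleGraph.Walk.length_copy] at this
    omega
  have hgeo : ∀ (d : ℕ) (i j : ℤ), i ≤ j → j ≤ i + L → (v i)⁻¹ * v j ∈ stepSet a b ^ d →
      j - i ≤ d ∨ L ≤ j - i + d := by
    intro d i j hij hjL hd
    have := hgeo (j - i).toNat d i (by omega)
      (by rwa [Int.toNat_of_nonneg (by omega), add_sub_cancel])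
    omega
  clear_value e u v
  have hpath : ∀ (i : ℤ) (n : ℕ), (v i)⁻¹ * v (i + n) ∈ stepSet a b ^ n := by
    intro i n
    induction n with
    | zero => simp
    | succ n ih =>
      have h1 : (v i)⁻¹ * v (i + (n + 1 : ℕ)) =
          (v i)⁻¹ * v (i + n) * (a ^ e (i + n) * b ^ u (i + n)) := by
        rw [Nat.cast_succ, ← add_assoc, hvs (i + n)]; group
      rw [h1, pow_succ]
      refine Set.mul_mem_mul ih ?_
      rcases letter (i + n) with ⟨h | h, h'⟩ | ⟨h, h' | h'⟩ <;> simp [h, h', stepSet]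
  have hpath : ∀ i j : ℤ, i ≤ j → (v i)⁻¹ * v j ∈ stepSet a b ^ (j - i).toNat := by
    intro i j hij
    have := hpath i (j - i).toNat
    rwa [Int.toNat_of_nonneg (by omega), add_sub_cancel] at this
  have hb : b ∈ stepSet a b := by simp [stepSet]
  have hb' : b⁻¹ ∈ stepSet a b := by simp [stepSet]
  have hhs : ∀ i, (ht (v (i + 1))).toAdd = (ht (v i)).toAdd + u i := fun i => by
    rw [hvs, map_mul ht, map_mul ht, map_zpow ht, map_zpow ht, hta, htb]
    simp
  have hcomm : ∀ (i j k : ℤ), (ht (v i)).toAdd = (ht (v j)).toAdd →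
      (v i)⁻¹ * v j * a ^ k = a ^ k * ((v i)⁻¹ * v j) := fun i j k h =>
    (commute_of_height_eq ht rel hta htb gen h).zpow_right k
  have hhalf : ∀ k : ℤ, (k = 1 ∨ k = -1) → ∃ k' : ℤ, (k' = 1 ∨ k' = -1) ∧ c * k' = k + k := by
    rintro k (rfl | rfl)
    · rcases hc with rfl | rfl
      · exact ⟨1, by norm_num⟩
      · exact ⟨-1, by norm_num⟩
    · rcases hc with rfl | rfl
      · exact ⟨-1, by norm_num⟩
      · exact ⟨1, by norm_num⟩
  have hva : ∀ i, e i ≠ 0 → v (i + 1) = v i * a ^ e i ∧ (e i = 1 ∨ e i = -1) := fun i h => by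
    have h1 := letter i
    have h2 : u i = 0 := by omega
    rw [hvs, h2, zpow_zero, mul_one]
    exact ⟨rfl, by omega⟩
  have hvb : ∀ i, u i ≠ 0 → v (i + 1) = v i * b ^ u i := fun i h => by
    have h1 := letter i
    have h2 : e i = 0 := by omega
    rw [hvs, h2, zpow_zero, one_mul]
  refine ShortcutFreeLoop.false (L := L) (c := c)
    { e := e, u := u, h := fun i => (ht (v i)).toAdd, x := fun i => x (v i)
      six_le := by omega
      abs_c := by rcases hc with rfl | rfl <;> norm_num
      letter := letter
      h_succ := hhs
      x_succ := fun i => ?_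
      e_add := heL
      u_add := huL
      h_add := fun i => by rw [hvL]
      x_add := fun i => by rw [hvL]
      opposite := fun i j hij hjL h h0 h1 => ?_
      square_up := fun i t h0 h1 hit htL hu h => ?_
      square_down := fun i t h0 h1 hti hiL hu h => ?_
      bump := fun i h0 h1 h2 => ?_
      reduced := fun i h0 h1 => ?_ }
  · have hxa' : ∀ g, x (g * a⁻¹) = x g - (c : ℚ) ^ (ht g).toAdd := fun g => by
      have := hxa (g * a⁻¹)
      rw [inv_mul_cancel_right, map_mul, map_inv, hta, inv_one, mul_one] at this
      linarith
    have hxb' : ∀ g, x (g * b⁻¹) = x g := fun g => by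
      have := hxb (g * b⁻¹)
      rwa [inv_mul_cancel_right, eq_comm] at this
    rw [hvs]
    rcases letter i with ⟨h | h, h'⟩ | ⟨h, h' | h'⟩ <;>
      simp [h, h', hxa, hxa', hxb, hxb', sub_eq_add_neg]
  · have hi := hva i h0
    have hj := hva j (by omega)
    have hh : (ht (v (i + 1))).toAdd = (ht (v j)).toAdd := by
      have h1 := hhs i
      have h2 := letter i
      omega
    -- `a^ε w a^{-ε} = w` for `w` of height 0: this saves two letters.
    have key : (v i)⁻¹ * v (j + 1) = (v (i + 1))⁻¹ * v j := by
      rw [hj.1, h1, ← mul_assoc, show (v i)⁻¹ * v j = a ^ e i * ((v (i + 1))⁻¹ * v j) by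
        rw [hi.1]; group, ← hcomm _ _ _ hh]
      group
    have := hgeo _ i (j + 1) (by omega) (by omega) (key ▸ hpath (i + 1) j (by omega))
    omega
  · have hi := hva i h0
    have hi' := hva (i + 1) (by omega)
    have hh : (ht (v (i + 1 + 1))).toAdd = (ht (v t)).toAdd := by
      have h1 := hhs i
      have h2 := letter i
      have h3 := hhs (i + 1)
      have h4 := letter (i + 1)
      omega
    obtain ⟨k, hk, hk'⟩ := hhalf _ hi.2
    -- `a^{2ε} w b = w a^{2ε} b = w b a^k` with `c * k = 2ε`: this saves one letter.
    have key : (v i)⁻¹ * v (t + 1) = (v (i + 1 + 1))⁻¹ * v t * b * a ^ k := by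
      rw [mul_assoc _ b, mul_zpow_of_conj rel, hk', ← mul_assoc, hcomm _ _ _ hh,
        hvb t (by omega), hu, hi'.1, hi.1, h1]
      group
    have hm : (v i)⁻¹ * v (t + 1) ∈ stepSet a b ^ ((t - (i + 1 + 1)).toNat + 1 + 1) := by
      rw [key, pow_succ, pow_succ]
      exact Set.mul_mem_mul (Set.mul_mem_mul (hpath _ _ (by omega)) hb) (zpow_mem_stepSet_left hk)
    have := hgeo _ i (t + 1) (by omega) (by omega) hm
    omega
  · have hi := hva i h0
    have hi' := hva (i + 1) (by omega)
    obtain ⟨k, hk, hk'⟩ := hhalf _ hi.2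
    -- The mirror image: `b⁻¹ w a^{2ε} = b⁻¹ a^{2ε} w = a^k b⁻¹ w`.
    have key : (v t)⁻¹ * v (i + 1 + 1) = a ^ k * b⁻¹ * ((v (t + 1))⁻¹ * v i) := by
      have h3 : a ^ k * b⁻¹ = b⁻¹ * a ^ (e i + e i) := by
        rw [← hk', eq_inv_mul_iff_mul_eq, ← mul_assoc, mul_zpow_of_conj rel, mul_inv_cancel_right]
      rw [h3, mul_assoc, ← hcomm _ _ _ h, hvb t (by omega), hu, hi'.1, hi.1, h1]
      group
    have hm : (v t)⁻¹ * v (i + 1 + 1) ∈ stepSet a b ^ (1 + 1 + (i - (t + 1)).toNat) := by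
      rw [key, pow_add, pow_succ, pow_one]
      exact Set.mul_mem_mul (Set.mul_mem_mul (zpow_mem_stepSet_left hk) hb') (hpath _ _ (by omega))
    have := hgeo _ t (i + 1 + 1) (by omega) (by omega) hm
    omega
  · have hi := hvb i (by omega)
    have hi' := hva (i + 1) (by have := letter (i + 1); omega)
    have hi2 := hvb (i + 2) (by omega)
    -- `b a^ε b⁻¹ = a ^ (c * ε)` replaces three edges by two, a shortcut precisely because `L ≥ 6`.
    have hm : (v i)⁻¹ * v (i + 2 + 1) ∈ stepSet a b ^ (1 + 1) := by
      have key : (v i)⁻¹ * v (i + 2 + 1) = a ^ (c * e (i + 1)) := by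
        rw [hi2, h2, show i + 2 = i + 1 + 1 by ring, hi'.1, hi, h0,
          ← mul_inv_cancel_right (a ^ (c * e (i + 1))) b, ← mul_zpow_of_conj rel]
        group
      rw [key, pow_succ, pow_one]
      rcases hc with rfl | rfl
      · rw [two_mul, zpow_add]
        exact Set.mul_mem_mul (zpow_mem_stepSet_left hi'.2) (zpow_mem_stepSet_left hi'.2)
      · rw [show -2 * e (i + 1) = -e (i + 1) + -e (i + 1) by ring, zpow_add]
        have hn : -e (i + 1) = 1 ∨ -e (i + 1) = -1 := by omega
        exact Set.mul_mem_mul (zpow_mem_stepSet_left hn) (zpow_mem_stepSet_left hn)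
    have := hgeo _ i (i + 2 + 1) (by omega) (by omega) hm
    omega
  · have hm : (v i)⁻¹ * v (i + 1 + 1) ∈ stepSet a b ^ 0 := by
      rw [hvb (i + 1) (by omega), hvb i h0, h1]
      simp
    have := hgeo _ i (i + 1 + 1) (by omega) (by omega) hm
    omega

end Group

/-! ### Height and affine action of `BS(m, n)`. -/

lemma perm_sub_eq_of_closure {G : Type*} [Group G] {S : Set G} (gen : Subgroup.closure S = ⊤)
    (f : G →* Equiv.Perm ℚ) (ht : G →* Multiplicative ℤ) {q : ℚ} (hq : q ≠ 0)
    (hS : ∀ s ∈ S, ∀ y z, f s y - f s z = q ^ (ht s).toAdd * (y - z)) (g : G) (y z : ℚ) :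
    f g y - f g z = q ^ (ht g).toAdd * (y - z) := by
  have hg : g ∈ Subgroup.closure S := gen ▸ Subgroup.mem_top g
  induction hg using Subgroup.closure_induction generalizing y z with
  | mem s hs => exact hS s hs y z
  | one => simp
  | mul g g' _ _ ih ih' =>
    rw [map_mul, map_mul, Equiv.Perm.mul_apply, Equiv.Perm.mul_apply, ih, ih', toAdd_mul,
      zpow_add₀ hq, mul_assoc]
  | inv g _ ih =>
    have h := ih ((f g)⁻¹ y) ((f g)⁻¹ z)
    simp only [Equiv.Perm.coe_inv, Equiv.apply_symm_apply] at h
    rw [map_inv, map_inv, toAdd_inv, zpow_neg, h, Equiv.Perm.coe_inv, inv_mul_cancel_left₀ (zpow_ne_zero _ hq)]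

lemma addRight_one_zpow (k : ℤ) :
    (Equiv.addRight (1 : ℚ) : Equiv.Perm ℚ) ^ k = Equiv.addRight (k : ℚ) := by
  induction k using Int.induction_on with
  | zero => ext; simp
  | succ k ih => rw [zpow_add_one, ih]; ext y; simp; ring
  | pred k ih => rw [zpow_sub_one, ih]; ext y; simp; ring

namespace BaumslagSolitar

variable (m n : ℤ)

lemma rel : b m n * a m n ^ m * (b m n)⁻¹ = a m n ^ n := by
  have h := PresentedGroup.one_of_mem (rels := {baumslagSolitarRelator m n})
    (Set.mem_singleton (baumslagSolitarRelator m n))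
  exact mul_inv_eq_one.1 h

lemma closure_eq_top : Subgroup.closure {a m n, b m n} = ⊤ := by
  rw [← PresentedGroup.closure_range_of]
  congr 1
  ext g
  simp [a, b, Fin.exists_fin_two, eq_comm]

/-- The exponent sum of `b`. -/
def height : BaumslagSolitar m n →* Multiplicative ℤ :=
  PresentedGroup.toGroup (f := ![1, Multiplicative.ofAdd 1]) (by
    rintro r rfl
    simp [baumslagSolitarRelator])

lemma height_a : height m n (a m n) = 1 := by
  simp [height, a]

lemma height_b : height m n (b m n) = Multiplicative.ofAdd 1 := by
  simp [height, b]

variable {m n}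

/-- The action on `ℚ` in which `a` is the translation by `1` and `b` the multiplication by
`n / m`. -/
noncomputable def affineAction (hm : m ≠ 0) (hn : n ≠ 0) :
    BaumslagSolitar m n →* Equiv.Perm ℚ :=
  PresentedGroup.toGroup
    (f := ![Equiv.addRight 1, Equiv.mulLeft₀ ((n : ℚ) / m) (by positivity)]) (by
    rintro r rfl
    have hm' : (m : ℚ) ≠ 0 := by exact_mod_cast hm
    have hn' : (n : ℚ) ≠ 0 := by exact_mod_cast hn
    simp only [baumslagSolitarRelator, map_mul, map_inv, map_zpow, FreeGroup.lift_apply_of,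
      Matrix.cons_val_zero, Matrix.cons_val_one, addRight_one_zpow,
      mul_inv_eq_iff_eq_mul, one_mul]
    ext y
    simp
    field_simp)

lemma affineAction_a (hm : m ≠ 0) (hn : n ≠ 0) (y : ℚ) :
    affineAction hm hn (a m n) y = y + 1 := by
  simp [affineAction, a]

lemma affineAction_b (hm : m ≠ 0) (hn : n ≠ 0) (y : ℚ) :
    affineAction hm hn (b m n) y = n / m * y := by
  simp [affineAction, b]

lemma affineAction_sub (hm : m ≠ 0) (hn : n ≠ 0) (g : BaumslagSolitar m n) (y z : ℚ) :
    affineAction hm hn g y - affineAction hm hn g z =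
      ((n : ℚ) / m) ^ (height m n g).toAdd * (y - z) := by
  refine perm_sub_eq_of_closure (closure_eq_top m n) _ _ (by positivity) ?_ g y z
  rintro s (rfl | rfl) y z
  · simp [affineAction_a, height_a]
  · simp [affineAction_b, height_b, mul_sub]

lemma affineAction_mul_a (hm : m ≠ 0) (hn : n ≠ 0) (g : BaumslagSolitar m n) :
    affineAction hm hn (g * a m n) 0 =
      affineAction hm hn g 0 + ((n : ℚ) / m) ^ (height m n g).toAdd := by
  have := affineAction_sub hm hn g 1 0
  rw [map_mul, Equiv.Perm.mul_apply, affineAction_a, zero_add]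
  linarith

lemma affineAction_mul_b (hm : m ≠ 0) (hn : n ≠ 0) (g : BaumslagSolitar m n) :
    affineAction hm hn (g * b m n) 0 = affineAction hm hn g 0 := by
  rw [map_mul, Equiv.Perm.mul_apply, affineAction_b, mul_zero]

theorem isKChordal_six_of_abs_one_two (hm : |m| = 1) (hn : |n| = 2) :
    IsKChordal (cayleyGraph m n) 6 := by
  have hm' : m = 1 ∨ m = -1 := eq_or_eq_neg_of_abs_eq hm
  have hn' : n = 2 ∨ n = -2 := eq_or_eq_neg_of_abs_eq hn
  have hm0 : m ≠ 0 := by omega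
  have hn0 : n ≠ 0 := by omega
  have hr := rel m n
  -- As `m = ±1`, raising the relation to the power `m` gives `b a b⁻¹ = a ^ (m * n)`.
  refine isKChordal_six_of_conj (c := m * n) (height m n) ?_ ?_ (height_a m n) (height_b m n)
    (closure_eq_top m n) (fun g => affineAction hm0 hn0 g 0) (fun g => ?_)
    (affineAction_mul_b hm0 hn0)
  · rcases hm' with rfl | rfl <;> omega
  · rw [mul_comm, zpow_mul, ← hr, conj_zpow, ← zpow_mul]
    rcases hm' with rfl | rfl <;> simp
  · rw [affineAction_mul_a]
    rcases hm' with rfl | rfl <;> simp [div_neg]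

/-- Inverting `b` interchanges the roles of `m` and `n`, which reduces `|m| = 2`, `|n| = 1` to the
same criterion with the height negated. -/
lemma cayleyGraph_eq_mulCayley_inv (m n : ℤ) :
    cayleyGraph m n = SimpleGraph.mulCayley {a m n, (b m n)⁻¹} := by
  ext g g'
  simp only [cayleyGraph, SimpleGraph.mulCayley_adj', Set.mem_insert_iff, Set.mem_singleton_iff,
    exists_eq_or_imp, exists_eq_left, mul_inv_eq_iff_eq_mul, eq_mul_inv_iff_mul_eq]
  tauto

theorem isKChordal_six_of_abs_two_one (hm : |m| = 2) (hn : |n| = 1) :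
    IsKChordal (cayleyGraph m n) 6 := by
  have hm' : m = 2 ∨ m = -2 := eq_or_eq_neg_of_abs_eq hm
  have hn' : n = 1 ∨ n = -1 := eq_or_eq_neg_of_abs_eq hn
  have hm0 : m ≠ 0 := by omega
  have hn0 : n ≠ 0 := by omega
  have hr : (b m n)⁻¹ * a m n ^ n * (b m n)⁻¹⁻¹ = a m n ^ m := by
    rw [← rel m n]; group
  rw [cayleyGraph_eq_mulCayley_inv]
  refine isKChordal_six_of_conj (c := n * m) (height m n)⁻¹ ?_ ?_ ?_ ?_ ?_
    (fun g => affineAction hm0 hn0 g 0) (fun g => ?_) (fun g => ?_)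
  · rcases hn' with rfl | rfl <;> omega
  · rw [mul_comm, zpow_mul, ← hr, conj_zpow, ← zpow_mul]
    rcases hn' with rfl | rfl <;> simp
  · simp [height_a]
  · simp [height_b]
  · rw [eq_top_iff, ← closure_eq_top m n, Subgroup.closure_le]
    rintro s (rfl | rfl)
    · exact Subgroup.subset_closure (by simp)
    · exact (Subgroup.inv_mem_iff _).1 (Subgroup.subset_closure (by simp))
  · rw [affineAction_mul_a]
    have hq : ((n : ℚ) / m) = ((n * m : ℤ) : ℚ)⁻¹ := by
      rcases hn' with rfl | rfl <;> simp [neg_div, inv_neg]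
    rw [hq, MonoidHom.inv_apply, toAdd_inv, inv_zpow']
  · have := affineAction_mul_b hm0 hn0 (g * (b m n)⁻¹)
    rw [inv_mul_cancel_right] at this
    exact this.symm

end BaumslagSolitar

theorem theorem5p7 :
    IsKChordal (BaumslagSolitar.cayleyGraph 1 2) 6 ∧
      ∀ m n : ℤ, (|m| = 1 ∧ |n| = 2) ∨ (|m| = 2 ∧ |n| = 1) →
        IsKChordal (BaumslagSolitar.cayleyGraph m n) 6 := by
  refine ⟨BaumslagSolitar.isKChordal_six_of_abs_one_two (by norm_num) (by norm_num), ?_⟩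
  rintro m n (⟨hm, hn⟩ | ⟨hm, hn⟩)
  · exact BaumslagSolitar.isKChordal_six_of_abs_one_two hm hn
  · exact BaumslagSolitar.isKChordal_six_of_abs_two_one hm hn
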